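/- Let $(R,\mathfrak m)$ be a noetherian local ring, let $E$ be an $R$-injective hull of the residue field $R/\mathfrak m$, and for an $R$-module $M$ let $D(M)=\operatorname{Hom}_R(M,E)$ denote its Matlis dual. Let $I\subseteq R$ be an ideal, let $n,h\in\mathbb N$, let $\underline x=x_1,\dots,x_h\in I$ be an arbitrary sequence of elements of $I$, and let $N$ be an arbitrary $R$-module. Put $D:=D(H^n_I(N))$, where $H^n_I$ is the $n$-th local cohomology functor with support in $I$. Then the following two statements are equivalent: (i) $\underline x$ is a $D$-quasiregular sequence, i.e. for every $i=1,\dots,h$, multiplication by $x_i$ on $D/(x_1,\dots,x_{i-1})D$ is injective. (ii) The canonical map $D/\underline xD\to H^h_{\underline xR}(D)$ is injective. Here $H^h_{\underline xR}(D)$ is described as the direct limit $\varinjlim_{l\in\mathbb N} D/(x_1^l,\dots,x_h^l)D$, whose transition maps are induced by multiplication by $x_1\cdots x_h$, and the canonical map is the map from the term $l=1$ to the limit. -/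

import Mathlib

universe u

/-- `ι : K → E` is an `R`-injective hull of the `R`-module `K`: the map `ι` is injective, the
module `E` is injective, and `E` is an essential extension of the image of `ι`, that is, every
nonzero submodule of `E` meets that image nontrivially. -/
structure IsInjectiveHull {R : Type u} [CommRing R] {K E : Type u}
    [AddCommGroup K] [Module R K] [AddCommGroup E] [Module R E] (ι : K →ₗ[R] E) : Prop where
  injective_map : Function.Injective ι
  injective_module : Module.Injective R E
  essential : ∀ W : Submodule R E, W ⊓ LinearMap.range ι = ⊥ → W = ⊥

/-- The Matlis dual `D(M) = Hom_R(M, E)` of `M`, taken with respect to the module `E`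
(an injective hull of the residue field of a local ring `R`). -/
abbrev MatlisDual (R : Type u) [CommRing R] (E M : Type u)
    [AddCommGroup E] [Module R E] [AddCommGroup M] [Module R M] : Type u :=
  M →ₗ[R] E

section TopLocalCohomology

variable {R : Type u} [CommRing R] {h : ℕ} (x : Fin h → R)
  (M : Type u) [AddCommGroup M] [Module R M]

/-- The submodule `(x₁ˡ, …, x_hˡ) M` of `M`. -/
def powSubmodule (l : ℕ) : Submodule R M :=
  Ideal.span (Set.range fun i => x i ^ l) • (⊤ : Submodule R M)

theorem powSubmodule_le_comap {l k : ℕ} (hlk : l ≤ k) :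
    powSubmodule x M l ≤
      (powSubmodule x M k).comap (LinearMap.lsmul R M ((∏ i, x i) ^ (k - l))) := by
  unfold powSubmodule
  rw [Submodule.smul_le]
  intro r hr m _
  rw [Submodule.mem_comap, LinearMap.lsmul_apply, ← mul_smul]
  refine Submodule.smul_mem_smul ?_ Submodule.mem_top
  induction hr using Submodule.span_induction with
  | mem r hr =>
    obtain ⟨i, rfl⟩ := hr
    have hdvd : x i ^ k ∣ (∏ i, x i) ^ (k - l) * x i ^ l := by
      have hk : x i ^ k = x i ^ (k - l) * x i ^ l := by
        rw [← pow_add, Nat.sub_add_cancel hlk]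
      rw [hk]
      exact mul_dvd_mul_right
        (pow_dvd_pow_of_dvd (Finset.dvd_prod_of_mem x (Finset.mem_univ i)) _) _
    exact Ideal.mem_of_dvd _ hdvd (Ideal.subset_span ⟨i, rfl⟩)
  | zero => simp
  | add a b _ _ ha hb => rw [mul_add]; exact Ideal.add_mem _ ha hb
  | smul a b _ hb => rw [smul_eq_mul, mul_left_comm]; exact Ideal.mul_mem_left _ _ hb

/-- The transition map `M/(x₁ˡ, …, x_hˡ)M → M/(x₁ᵏ, …, x_hᵏ)M` for `l ≤ k`: it is induced by
multiplication by `(x₁ ⋯ x_h)^(k - l)`. -/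
def powTransition (l k : ℕ) (hlk : l ≤ k) :
    (M ⧸ powSubmodule x M l) →ₗ[R] (M ⧸ powSubmodule x M k) :=
  Submodule.mapQ _ _ (LinearMap.lsmul R M ((∏ i, x i) ^ (k - l))) (powSubmodule_le_comap x M hlk)

/-- The top local cohomology module `H^h_{xR}(M)` of `M` with support in the ideal generated by
`x = x₁, …, x_h`, described as the direct limit of the modules `M/(x₁ˡ, …, x_hˡ)M`, whose
transition maps are induced by multiplication by `x₁ ⋯ x_h`. -/
abbrev TopLocalCohomology : Type u :=
  Module.DirectLimit (fun l : ℕ => M ⧸ powSubmodule x M l) (powTransition x M)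

/-- The canonical map `M/xM → H^h_{xR}(M)`: the inclusion of the term `l = 1` into the limit. -/
noncomputable def canonicalMap :
    (M ⧸ (Ideal.span (Set.range x) • (⊤ : Submodule R M))) →ₗ[R] TopLocalCohomology x M :=
  Submodule.liftQ _
    (Module.DirectLimit.of R ℕ (fun l : ℕ => M ⧸ powSubmodule x M l) (powTransition x M) 1 ∘ₗ
      (powSubmodule x M 1).mkQ)
    (by
      intro m hm
      have hm' : m ∈ powSubmodule x M 1 := by simpa [powSubmodule] using hm
      rw [LinearMap.mem_ker, LinearMap.comp_apply,
        (Submodule.Quotient.mk_eq_zero (powSubmodule x M 1)).2 hm' |> fun e =>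
          (show (powSubmodule x M 1).mkQ m = 0 from e), map_zero])

end TopLocalCohomology

/-! Write H = H^n_I(N). Matlis duality turns both statements into statements about H. Since E is
injective, an element of D lies in (y)D exactly when it vanishes on 0 :_H (y); since E cogenerates,
surjectivity can be tested after dualizing. So (i) says that each x_i is surjective on 0 :_H (x_1,
..., x_{i-1}), which is `IsCoregular`, and (ii) becomes `ProdPowSurjective`.

Coregularity makes Koszul-type systems solvable (`IsCoregular.powSystemsSolvable`), and their
solutions correct the lifts needed for (ii). Conversely, every element of H is killed by a power of
I, hence by all monomials in x of some degree; `ProdPowSurjective.exists_smul_eq` divides it by x_i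
by induction on that degree. The property passes to 0 :_H x_1, so the argument repeats. Torsion is
needed only for this converse. -/

/-! ### Coregular sequences and surjectivity of powers of the product -/

section Torsion

open Submodule

variable {R : Type u} [CommRing R]

/-- Coregular sequences: `x₁` is surjective on `H`, and recursively the tail is
coregular on `0 :_H x₁`. -/
def IsCoregular : List R → ∀ (H : Type u) [AddCommGroup H] [Module R H], Prop
  | [], _, _, _ => True
  | r :: rs, H, _, _ => (∀ y : H, ∃ z : H, r • z = y) ∧ IsCoregular rs (torsionBy R H r)

/-- Every system `xᵢ ^ l • k = vᵢ` satisfying `xⱼ ^ l • vᵢ = xᵢ ^ l • vⱼ` has a solution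
in the submodule `K`. -/
def PowSystemsSolvable {H : Type u} [AddCommGroup H] [Module R H] {h : ℕ} (x : Fin h → R) (l : ℕ)
    (K : Submodule R H) : Prop :=
  ∀ v : Fin h → H, (∀ i, v i ∈ K) → (∀ i j, x j ^ l • v i = x i ^ l • v j) →
    ∃ k ∈ K, ∀ i, x i ^ l • k = v i

variable {H : Type u} [AddCommGroup H] [Module R H]

/-- Dévissage on m: solve for r • v in 0 :_H r ^ m and lift the solution through r; what remains is
a system in 0 :_H r. -/
theorem PowSystemsSolvable.torsionBy_pow {h : ℕ} {x : Fin h → R} {l : ℕ} {r : R}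
    (hr : ∀ y : H, ∃ z : H, r • z = y) (hS : PowSystemsSolvable x l (torsionBy R H r)) (m : ℕ) :
    PowSystemsSolvable x l (torsionBy R H (r ^ m)) := by
  induction m with
  | zero =>
    intro v hv _
    refine ⟨0, zero_mem _, fun i => ?_⟩
    have := hv i
    simp_all
  | succ m ih =>
    intro v hv hc
    obtain ⟨k, hk, hkv⟩ := ih (fun i => r • v i)
      (fun i => by
        have := hv i
        rw [mem_torsionBy_iff] at this ⊢
        rwa [smul_smul, ← pow_succ])
      (fun i j => by rw [smul_comm, hc, smul_comm])
    obtain ⟨k', rfl⟩ := hr k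
    obtain ⟨z, hz, hzv⟩ := hS (fun i => v i - x i ^ l • k')
      (fun i => by rw [mem_torsionBy_iff, smul_sub, smul_comm, hkv, sub_self])
      (fun i j => by rw [smul_sub, smul_sub, hc, smul_comm])
    rw [mem_torsionBy_iff] at hk hz
    refine ⟨k' + z, ?_, fun i => by rw [smul_add, hzv, add_sub_cancel]⟩
    rw [mem_torsionBy_iff, smul_add, pow_succ, mul_smul, hk, mul_smul, hz, smul_zero, add_zero]

theorem IsCoregular.exists_pow_smul_eq {r : R} {rs : List R} (hr : IsCoregular (r :: rs) H)
    (m : ℕ) (y : H) : ∃ z : H, r ^ m • z = y := by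
  induction m generalizing y with
  | zero => exact ⟨y, by simp⟩
  | succ m ihm =>
    obtain ⟨z, rfl⟩ := ihm y
    obtain ⟨z, rfl⟩ := hr.1 z
    exact ⟨z, by rw [pow_succ, mul_smul]⟩

/-- This is the vanishing of first Koszul cohomology of the x_i ^ l. Solving the equation of x_0
alone leaves, by compatibility, a system in 0 :_H x_0 ^ l, whose solutions do not disturb that
equation. -/
theorem IsCoregular.powSystemsSolvable (l : ℕ) : ∀ {h : ℕ} (x : Fin h → R) {H : Type u}
    [AddCommGroup H] [Module R H], IsCoregular (List.ofFn x) H →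
      PowSystemsSolvable x l (⊤ : Submodule R H) := by
  intro h
  induction h with
  | zero => intro x H _ _ _ v _ _; exact ⟨0, trivial, fun i => i.elim0⟩
  | succ h ih =>
    intro x H _ _ hx v _ hc
    rw [List.ofFn_succ] at hx
    have hx' := hx
    obtain ⟨hsurj, hx⟩ := hx
    have hK : PowSystemsSolvable (fun i : Fin h => x i.succ) l (torsionBy R H (x 0)) := by
      intro w hw hwc
      obtain ⟨k, -, hk⟩ := ih _ hx (fun i => ⟨w i, hw i⟩) (fun _ => trivial)
        (fun i j => Subtype.ext (hwc i j))
      exact ⟨k, k.2, fun i => congrArg Subtype.val (hk i)⟩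
    obtain ⟨k, hk⟩ := hx'.exists_pow_smul_eq l (v 0)
    obtain ⟨z, hz, hzv⟩ := hK.torsionBy_pow hsurj l (fun i => v i.succ - x i.succ ^ l • k)
      (fun i => by rw [mem_torsionBy_iff, smul_sub, hc, smul_comm (x 0 ^ l), hk, sub_self])
      (fun i j => by rw [smul_sub, smul_sub, hc, smul_comm])
    refine ⟨k + z, trivial, Fin.cases ?_ fun i => ?_⟩
    · rw [smul_add, hk, (mem_torsionBy_iff _ _).1 hz, add_zero]
    · rw [smul_add, hzv, add_sub_cancel]

/-- Multiplication by `(x₁ ⋯ x_h) ^ m` maps `0 :_H (x₁ ^ (m + 1), …, x_h ^ (m + 1))` onto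
`0 :_H (x₁, …, x_h)`, for all `m`. -/
def ProdPowSurjective {h : ℕ} (x : Fin h → R) (H : Type u) [AddCommGroup H] [Module R H] : Prop :=
  ∀ (m : ℕ) (w : H), (∀ i, x i • w = 0) →
    ∃ z : H, (∀ i, x i ^ (m + 1) • z = 0) ∧ (∏ i, x i) ^ m • z = w

theorem IsCoregular.prodPowSurjective : ∀ {h : ℕ} {x : Fin h → R} {H : Type u}
    [AddCommGroup H] [Module R H], IsCoregular (List.ofFn x) H → ProdPowSurjective x H := by
  intro h
  induction h with
  | zero => intro x H _ _ _ m w _; exact ⟨w, fun i => i.elim0, by simp⟩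
  | succ h ih =>
    intro x H _ _ hx m w hw
    rw [List.ofFn_succ] at hx
    obtain ⟨⟨u, hu0⟩, hu, huw⟩ := ih hx.2 m ⟨w, hw 0⟩ (fun i => Subtype.ext (hw i.succ))
    replace hu : ∀ i : Fin h, x i.succ ^ (m + 1) • u = 0 := fun i => congrArg Subtype.val (hu i)
    replace huw : (∏ i : Fin h, x i.succ) ^ m • u = w := congrArg Subtype.val huw
    obtain ⟨z, rfl⟩ := hx.exists_pow_smul_eq m u
    have hK : PowSystemsSolvable (fun i : Fin h => x i.succ) (m + 1) (torsionBy R H (x 0)) := by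
      intro w hw hwc
      obtain ⟨k, -, hk⟩ := hx.2.powSystemsSolvable (m + 1) _ (fun i => ⟨w i, hw i⟩)
        (fun _ => trivial) (fun i j => Subtype.ext (hwc i j))
      exact ⟨k, k.2, fun i => congrArg Subtype.val (hk i)⟩
    -- The lift z need not be killed by the x_i ^ (m + 1) with i > 0. Subtracting k removes this
    -- defect without changing x_0 ^ m • z.
    obtain ⟨k, hk, hkz⟩ := hK.torsionBy_pow hx.1 m (fun i => x i.succ ^ (m + 1) • z)
      (fun i => by rw [mem_torsionBy_iff, smul_comm, hu]) (fun i j => smul_comm _ _ _)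
    rw [mem_torsionBy_iff] at hk
    have hzk : x 0 ^ m • (z - k) = x 0 ^ m • z := by rw [smul_sub, hk, sub_zero]
    refine ⟨z - k, ?_, ?_⟩
    · refine Fin.cases ?_ fun i => ?_
      · rw [pow_succ', mul_smul, hzk]
        exact hu0
      · rw [smul_sub, ← hkz i, sub_self]
    · rw [Fin.prod_univ_succ, mul_comm, mul_pow, mul_smul, hzk, huw]

theorem ProdPowSurjective.torsionBy {h : ℕ} {x : Fin (h + 1) → R} (hx : ProdPowSurjective x H) :
    ProdPowSurjective (fun i : Fin h => x i.succ) (torsionBy R H (x 0)) := by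
  rintro m ⟨w, hw0⟩ hw
  obtain ⟨z, hz, hzw⟩ := hx m w (Fin.cases hw0 fun i => congrArg Subtype.val (hw i))
  refine ⟨⟨x 0 ^ m • z, ?_⟩, fun i => Subtype.ext ?_, Subtype.ext ?_⟩
  · rw [mem_torsionBy_iff, smul_smul, ← pow_succ', hz]
  · change x i.succ ^ (m + 1) • x 0 ^ m • z = 0
    rw [smul_comm, hz, smul_zero]
  · change (∏ i : Fin h, x i.succ) ^ m • x 0 ^ m • z = w
    rw [smul_smul, ← mul_pow, mul_comm, ← Fin.prod_univ_succ, hzw]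

/-- Monomials of equal degree are separated: y is z times the complement of x^c in (∏ x_i) ^ (∑ c),
and b ≠ c exceeds c somewhere, pushing that exponent past ∑ c. -/
theorem ProdPowSurjective.exists_monomial_smul_eq {h : ℕ} {x : Fin h → R}
    (hx : ProdPowSurjective x H) (c : Fin h → ℕ) (w : H) (hw : ∀ i, x i • w = 0) :
    ∃ y : H, (∏ i, x i ^ c i) • y = w ∧
      ∀ b : Fin h → ℕ, ∑ i, b i = ∑ i, c i → b ≠ c → (∏ i, x i ^ b i) • y = 0 := by
  obtain ⟨z, hz, hzw⟩ := hx (∑ i, c i) w hw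
  have hle : ∀ i, c i ≤ ∑ i, c i := fun i =>
    Finset.single_le_sum (f := c) (fun _ _ => Nat.zero_le _) (Finset.mem_univ i)
  refine ⟨(∏ i, x i ^ (∑ j, c j - c i)) • z, ?_, fun b hb hbc => ?_⟩
  · rw [smul_smul, ← Finset.prod_mul_distrib, ← hzw, ← Finset.prod_pow]
    congr 1
    exact Finset.prod_congr rfl fun i _ => by rw [← pow_add, Nat.add_sub_cancel' (hle i)]
  · obtain ⟨i, hi⟩ : ∃ i, c i < b i := by
      by_contra! hcon
      exact hbc (funext fun i =>
        (Finset.sum_eq_sum_iff_of_le fun i _ => hcon i).1 hb i (Finset.mem_univ i))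
    rw [smul_smul, ← Finset.prod_mul_distrib]
    have hd : x i ^ (∑ j, c j + 1) ∣ ∏ j, x j ^ b j * x j ^ (∑ k, c k - c j) := by
      refine dvd_trans ?_ (Finset.dvd_prod_of_mem _ (Finset.mem_univ i))
      rw [← pow_add]
      exact pow_dvd_pow _ (by have := hle i; omega)
    obtain ⟨s, hs⟩ := hd
    rw [hs, mul_comm, mul_smul, hz, smul_zero]

/-- In the inductive step each x^a • y with |a| = m is killed by all x_j, so some z_a has x_i x^a •
z_a = x^a • y, while x_i x^b kills z_a for the other b of degree m. Then y - x_i • ∑ z_a is killed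
by all monomials of degree m. -/
theorem ProdPowSurjective.exists_smul_eq {h : ℕ} {x : Fin h → R} (hx : ProdPowSurjective x H)
    (i : Fin h) (m : ℕ) (y : H) (hy : ∀ a : Fin h → ℕ, ∑ i, a i = m → (∏ i, x i ^ a i) • y = 0) :
    ∃ z : H, x i • z = y := by
  induction m generalizing y with
  | zero => exact ⟨0, by simpa using (hy 0 (by simp)).symm⟩
  | succ m ih =>
    have hprod : ∀ (a : Fin h → ℕ) (j : Fin h),
        ∏ k, x k ^ (a + Pi.single j 1 : Fin h → ℕ) k = x j * ∏ k, x k ^ a k := fun a j => by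
      simp only [Pi.add_apply, pow_add, Finset.prod_mul_distrib]
      rw [mul_comm, Finset.prod_eq_single j (fun k _ hk => by simp [hk]) (by simp)]
      simp
    have hsum : ∀ (a : Fin h → ℕ) (j : Fin h),
        ∑ k, (a + Pi.single j 1 : Fin h → ℕ) k = ∑ k, a k + 1 := fun a j => by
      simp [Finset.sum_add_distrib]
    have hex : ∀ a : Fin h → ℕ, ∃ z : H, ∑ k, a k = m →
        (∏ k, x k ^ (a + Pi.single i 1 : Fin h → ℕ) k) • z = (∏ k, x k ^ a k) • y ∧
        ∀ b : Fin h → ℕ, ∑ k, b k = m → b ≠ a → (∏ k, x k ^ (b + Pi.single i 1 : Fin h → ℕ) k) • z = 0 := by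
      intro a
      by_cases ha : ∑ k, a k = m
      · obtain ⟨z, hz, hz'⟩ := hx.exists_monomial_smul_eq (a + Pi.single i 1)
          ((∏ k, x k ^ a k) • y) (fun j => by
            rw [smul_smul, ← hprod a j]
            exact hy _ (by rw [hsum, ha]))
        exact ⟨z, fun _ => ⟨hz, fun b hb hba =>
          hz' _ (by rw [hsum, hsum, ha, hb]) fun e => hba (add_right_cancel e)⟩⟩
      · exact ⟨0, fun e => absurd e ha⟩
    choose z hz using hex
    set s := ∑ a ∈ Finset.piAntidiag Finset.univ m, z a with hs
    obtain ⟨t, ht⟩ := ih (y - x i • s) (fun b hb => by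
      rw [smul_sub, smul_smul, mul_comm _ (x i), ← hprod b i, hs, Finset.smul_sum,
        Finset.sum_eq_single b, (hz b hb).1, sub_self]
      · intro a ha hab
        exact (hz a (Finset.mem_piAntidiag.1 ha).1).2 b hb hab.symm
      · intro hb'
        exact absurd (Finset.mem_piAntidiag.2 ⟨hb, fun i _ => Finset.mem_univ i⟩) hb')
    exact ⟨t + s, by rw [smul_add, ht, sub_add_cancel]⟩

theorem isCoregular_ofFn_iff_prodPowSurjective {h : ℕ} {x : Fin h → R} {H : Type u}
    [AddCommGroup H] [Module R H]
    (hH : ∀ y : H, ∃ m, ∀ r ∈ Ideal.span (Set.range x) ^ m, r • y = 0) :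
    IsCoregular (List.ofFn x) H ↔ ProdPowSurjective x H := by
  refine ⟨IsCoregular.prodPowSurjective, fun hx => ?_⟩
  induction h generalizing H with
  | zero => exact trivial
  | succ h ih =>
    rw [List.ofFn_succ]
    refine ⟨fun y => ?_, ih (fun y => ?_) hx.torsionBy⟩
    · obtain ⟨m, hm⟩ := hH y
      refine hx.exists_smul_eq 0 m y fun a ha => hm _ ?_
      rw [← ha, ← Finset.prod_pow_eq_pow_sum]
      exact Ideal.prod_mem_prod fun i _ =>
        Ideal.pow_mem_pow (Ideal.subset_span (Set.mem_range_self i)) _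
    · obtain ⟨m, hm⟩ := hH y
      refine ⟨m, fun r hr => Subtype.ext (hm r (Ideal.pow_right_mono (Ideal.span_mono ?_) m hr))⟩
      rintro _ ⟨i, rfl⟩
      exact ⟨i.succ, rfl⟩

end Torsion

/-! ### Matlis duality -/

section Dual

open Submodule RingTheory.Sequence
open scoped Pointwise

variable {R : Type u} [CommRing R]

/-- `E` cogenerates: nonzero elements are detected by homomorphisms to `E`. -/
def IsCogenerator (R : Type u) [CommRing R] (E : Type u) [AddCommGroup E] [Module R E] : Prop :=
  ∀ (Q : Type u) [AddCommGroup Q] [Module R Q] (q : Q), (∀ f : Q →ₗ[R] E, f q = 0) → q = 0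

variable {E : Type u} [AddCommGroup E] [Module R E]

theorem Module.Injective.exists_comp_eq_of_injective (hE : Module.Injective R E)
    {A B : Type u} [AddCommGroup A] [Module R A] [AddCommGroup B] [Module R B] (f : A →ₗ[R] B) (hf : Function.Injective f)
    (g : A →ₗ[R] E) : ∃ k : B →ₗ[R] E, k ∘ₗ f = g := by
  obtain ⟨k, hk⟩ := hE.out f hf g
  exact ⟨k, LinearMap.ext hk⟩

theorem Module.Injective.exists_comp_eq (hE : Module.Injective R E) {A B : Type u} [AddCommGroup A]
    [Module R A] [AddCommGroup B] [Module R B] (f : A →ₗ[R] B) (g : A →ₗ[R] E)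
    (hfg : LinearMap.ker f ≤ LinearMap.ker g) : ∃ k : B →ₗ[R] E, k ∘ₗ f = g := by
  obtain ⟨k, hk⟩ := hE.exists_comp_eq_of_injective ((LinearMap.ker f).liftQ f le_rfl)
    (LinearMap.ker_eq_bot.1 (Submodule.ker_liftQ_eq_bot _ _ _ le_rfl))
    ((LinearMap.ker f).liftQ g hfg)
  refine ⟨k, LinearMap.ext fun a => ?_⟩
  simpa using LinearMap.congr_fun hk ((LinearMap.ker f).mkQ a)

/-- The annihilator of q ≠ 0 lies in the maximal ideal, so R q maps onto the residue field and thus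
nontrivially to E; injectivity extends this map to Q. -/
theorem IsInjectiveHull.isCogenerator [IsLocalRing R] {ι : IsLocalRing.ResidueField R →ₗ[R] E}
    (hE : IsInjectiveHull ι) : IsCogenerator R E := by
  intro Q _ _ q hq
  by_contra h0
  let f : R →ₗ[R] Q := LinearMap.toSpanSingleton R Q q
  let g : R →ₗ[R] E := ι ∘ₗ Algebra.linearMap R (IsLocalRing.ResidueField R)
  obtain ⟨k, hk⟩ := hE.injective_module.exists_comp_eq f g (fun r hr => by
    have hr' : r • q = 0 := hr
    have : r ∈ IsLocalRing.maximalIdeal R := by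
      rw [IsLocalRing.mem_maximalIdeal, mem_nonunits_iff]
      intro hu
      exact h0 ((hu.smul_eq_zero).1 hr')
    rw [LinearMap.mem_ker]
    change ι (IsLocalRing.residue R r) = 0
    rw [(IsLocalRing.residue_eq_zero_iff r).2 this, map_zero])
  have h1 := LinearMap.congr_fun hk 1
  have h2 : k (f 1) = 0 := by simpa [f] using hq k
  have h3 : ι (IsLocalRing.residue R 1) = 0 := h1.symm.trans h2
  rw [map_one, ← map_zero ι] at h3
  exact one_ne_zero (hE.injective_map h3)

theorem IsCogenerator.mem_of_forall (hE : IsCogenerator R E) {Q : Type u} [AddCommGroup Q]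
    [Module R Q] (W : Submodule R Q) (q : Q) (h : ∀ f : Q →ₗ[R] E, W ≤ LinearMap.ker f → f q = 0) :
    q ∈ W := by
  rw [← Submodule.Quotient.mk_eq_zero]
  refine hE _ _ fun f => h (f ∘ₗ W.mkQ) fun w hw => ?_
  rw [LinearMap.mem_ker, LinearMap.comp_apply, Submodule.mkQ_apply,
    (Submodule.Quotient.mk_eq_zero W).2 hw, map_zero]

variable {H : Type u} [AddCommGroup H] [Module R H]

/-- For the converse, φ factors through z ↦ (y_i • z) because E is injective; the components of the
factor write φ as a combination of the y_i. -/
theorem mem_span_smul_top_iff (hE : Module.Injective R E) {h : ℕ} (y : Fin h → R) (φ : H →ₗ[R] E) :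
    φ ∈ Ideal.span (Set.range y) • (⊤ : Submodule R (H →ₗ[R] E)) ↔
      ∀ z : H, (∀ i, y i • z = 0) → φ z = 0 := by
  constructor
  · intro hφ z hz
    have hann : ∀ r ∈ Ideal.span (Set.range y), r • z = 0 := by
      have : Ideal.span (Set.range y) ≤ LinearMap.ker (LinearMap.toSpanSingleton R H z) := by
        rw [Ideal.span_le]
        rintro _ ⟨i, rfl⟩
        exact hz i
      exact fun r hr => this hr
    induction hφ using Submodule.smul_induction_on' with
    | smul r hr ψ _ => rw [LinearMap.smul_apply, ← map_smul, hann r hr, map_zero]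
    | add a _ b _ ha hb => rw [LinearMap.add_apply, ha, hb, add_zero]
  · intro hφ
    obtain ⟨k, rfl⟩ := hE.exists_comp_eq (LinearMap.pi fun i => LinearMap.lsmul R H (y i)) φ
      (fun z hz => hφ z fun i => congrFun hz i)
    have : k ∘ₗ (LinearMap.pi fun i => LinearMap.lsmul R H (y i)) =
        ∑ i, y i • (k ∘ₗ LinearMap.single R (fun _ => H) i) := by
      ext z
      have hz : (LinearMap.pi fun i => LinearMap.lsmul R H (y i)) z =
          ∑ i, y i • LinearMap.single R (fun _ : Fin h => H) i z := by
        ext j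
        simp [Pi.single_apply]
      rw [LinearMap.comp_apply, hz, map_sum]
      simp
    rw [this]
    exact Submodule.sum_mem _ fun i _ =>
      Submodule.smul_mem_smul (Ideal.subset_span (Set.mem_range_self i)) Submodule.mem_top

theorem isSMulRegular_dual_iff (hE' : IsCogenerator R E) (r : R) :
    IsSMulRegular (H →ₗ[R] E) r ↔ ∀ y : H, ∃ z : H, r • z = y := by
  constructor
  · intro hr y
    refine hE'.mem_of_forall (LinearMap.range (LinearMap.lsmul R H r)) y fun f hf => ?_
    have : f = 0 := hr (by
      ext z
      simpa using hf ⟨z, rfl⟩)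
    rw [this, LinearMap.zero_apply]
  · intro hr φ ψ hφ
    ext y
    obtain ⟨z, rfl⟩ := hr y
    simpa using LinearMap.congr_fun hφ z

theorem nonempty_quotSMulTop_dual_equiv (hE : Module.Injective R E) (r : R) :
    Nonempty (QuotSMulTop r (H →ₗ[R] E) ≃ₗ[R] (torsionBy R H r →ₗ[R] E)) := by
  let ρ : (H →ₗ[R] E) →ₗ[R] (torsionBy R H r →ₗ[R] E) :=
    LinearMap.lcomp R E (torsionBy R H r).subtype
  have hρ : Function.Surjective ρ := fun g =>
    hE.exists_comp_eq_of_injective _ (torsionBy R H r).injective_subtype g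
  have hk : r • (⊤ : Submodule R (H →ₗ[R] E)) = LinearMap.ker ρ := by
    ext φ
    rw [← Submodule.ideal_span_singleton_smul]
    have := mem_span_smul_top_iff hE (fun _ : Fin 1 => r) φ
    rw [Set.range_const] at this
    rw [this, LinearMap.mem_ker]
    constructor
    · intro hφ
      ext z
      exact hφ z fun _ => z.2
    · intro hφ z hz
      exact LinearMap.congr_fun hφ ⟨z, hz 0⟩
  exact ⟨(Submodule.quotEquivOfEq _ _ hk).trans (ρ.quotKerEquivOfSurjective hρ)⟩

theorem isWeaklyRegular_dual_iff_isCoregular (hE : Module.Injective R E) (hE' : IsCogenerator R E) :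
    ∀ (rs : List R) (H : Type u) [AddCommGroup H] [Module R H],
      IsWeaklyRegular (H →ₗ[R] E) rs ↔ IsCoregular rs H := by
  intro rs
  induction rs with
  | nil => intro H _ _; exact ⟨fun _ => trivial, fun _ => IsWeaklyRegular.nil R _⟩
  | cons r rs ih =>
    intro H _ _
    obtain ⟨e⟩ := nonempty_quotSMulTop_dual_equiv (H := H) hE r
    rw [isWeaklyRegular_cons_iff, isSMulRegular_dual_iff hE', e.isWeaklyRegular_congr, ih]
    rfl

/-! ### The direct limit and its canonical map -/

instance directedSystem_powTransition {h : ℕ} (x : Fin h → R) (M : Type u) [AddCommGroup M]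
    [Module R M] : DirectedSystem (fun l => M ⧸ powSubmodule x M l)
      (fun l k hlk => powTransition x M l k hlk) where
  map_self l m := by
    obtain ⟨m, rfl⟩ := Submodule.Quotient.mk_surjective _ m
    simp [powTransition]
  map_map i j k hij hjk m := by
    obtain ⟨m, rfl⟩ := Submodule.Quotient.mk_surjective _ m
    simp only [powTransition, Submodule.mapQ_apply, LinearMap.lsmul_apply, smul_smul, ← pow_add]
    congr 3
    omega

theorem canonicalMap_injective_iff {h : ℕ} (x : Fin h → R) (M : Type u) [AddCommGroup M]
    [Module R M] : Function.Injective (canonicalMap x M) ↔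
      ∀ (l : ℕ) (m : M), (∏ i, x i) ^ l • m ∈ powSubmodule x M (l + 1) →
        m ∈ Ideal.span (Set.range x) • (⊤ : Submodule R M) := by
  have hc : ∀ m : M, canonicalMap x M (Submodule.Quotient.mk m) =
      Module.DirectLimit.of R ℕ (fun l : ℕ => M ⧸ powSubmodule x M l) (powTransition x M) 1
        (Submodule.Quotient.mk m) := fun m => rfl
  rw [injective_iff_map_eq_zero]
  constructor
  · intro hinj l m hm
    rw [← Submodule.Quotient.mk_eq_zero]
    refine hinj _ ?_
    rw [hc, ← Module.DirectLimit.of_f (hij := Nat.le_add_left 1 l)]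
    have : powTransition x M 1 (l + 1) (Nat.le_add_left 1 l) (Submodule.Quotient.mk m) = 0 :=
      (Submodule.Quotient.mk_eq_zero _).2 (by simpa using hm)
    rw [this, map_zero]
  · intro hM m hm
    obtain ⟨m, rfl⟩ := Submodule.Quotient.mk_surjective _ m
    rw [hc] at hm
    obtain ⟨k, hk, hkm⟩ := Module.DirectLimit.of.zero_exact hm
    -- From stage 1 to stage k = l + 1 the transition is multiplication by the l-th power.
    obtain ⟨l, rfl⟩ := Nat.exists_eq_add_of_le' hk
    rw [Submodule.Quotient.mk_eq_zero]
    exact hM l m (by simpa using (Submodule.Quotient.mk_eq_zero _).1 hkm)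

theorem canonicalMap_dual_injective_iff (hE : Module.Injective R E) (hE' : IsCogenerator R E)
    {h : ℕ} (x : Fin h → R) :
    Function.Injective (canonicalMap x (H →ₗ[R] E)) ↔ ProdPowSurjective x H := by
  rw [canonicalMap_injective_iff]
  refine forall_congr' fun l => ?_
  simp only [powSubmodule, mem_span_smul_top_iff hE]
  constructor
  · intro hD w hw
    let K : Submodule R H := ⨅ i, torsionBy R H (x i ^ (l + 1))
    have hK : ∀ z, z ∈ K ↔ ∀ i, x i ^ (l + 1) • z = 0 := fun z => by simp [K]
    have := hE'.mem_of_forall (K.map (LinearMap.lsmul R H ((∏ i, x i) ^ l))) w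
      fun f hf => hD f (fun z hz => by
        rw [LinearMap.smul_apply, ← map_smul]
        exact hf ⟨z, (hK z).2 hz, rfl⟩) w hw
    obtain ⟨z, hz, hzw⟩ := this
    exact ⟨z, (hK z).1 hz, hzw⟩
  · intro hP φ hφ w hw
    obtain ⟨z, hz, rfl⟩ := hP w hw
    simpa using hφ z hz

end Dual

/-! ### Local cohomology is torsion -/

section LocalCohomologyTorsion

open CategoryTheory Limits Opposite

/-- The linear structure on the opposite of a linear category. -/
@[reducible]
def oppositeLinear (R C : Type*) [Semiring R] [Category* C] [Preadditive C] [Linear R C] :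
    Linear R Cᵒᵖ where
  homModule _ _ :=
    { smul := fun r f => (r • f.unop).op
      one_smul := fun f => congrArg Quiver.Hom.op (one_smul R f.unop)
      mul_smul := fun r s f => congrArg Quiver.Hom.op (mul_smul r s f.unop)
      smul_zero := fun r => congrArg Quiver.Hom.op (smul_zero r)
      smul_add := fun r f g => congrArg Quiver.Hom.op (smul_add r f.unop g.unop)
      add_smul := fun r s f => congrArg Quiver.Hom.op (add_smul r s f.unop)
      zero_smul := fun f => congrArg Quiver.Hom.op (zero_smul R f.unop) }
  smul_comp _ _ _ r f g := congrArg Quiver.Hom.op (Linear.comp_smul _ _ _ g.unop r f.unop)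
  comp_smul _ _ _ f r g := congrArg Quiver.Hom.op (Linear.smul_comp _ _ _ r g.unop f.unop)

instance homologyFunctor_linear {R D ι : Type*} [Semiring R] [Category* D] [Abelian D]
    [Linear R D] (c : ComplexShape ι) (n : ι) :
    (HomologicalComplex.homologyFunctor D c n).Linear R where
  map_smul f r := ShortComplex.homologyMap_smul
    ((HomologicalComplex.shortComplexFunctor D c n).map f) r

/-- Multiplication by r on a projective resolution lifts multiplication by r on X. -/
theorem leftDerived_map_smul_id {R C D : Type*} [Semiring R] [Category* C] [Abelian C]
    [HasProjectiveResolutions C] [Category* D] [Abelian D] [Linear R C] [Linear R D]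
    (F : C ⥤ D) [F.Additive] [F.Linear R] (n : ℕ) (r : R) (X : C) :
    (F.leftDerived n).map (r • 𝟙 X) = r • 𝟙 ((F.leftDerived n).obj X) := by
  let P := projectiveResolution X
  rw [F.leftDerived_map_eq n (P := P) (Q := P) (r • 𝟙 X) (r • 𝟙 P.complex) (by
    apply HomologicalComplex.to_single_hom_ext
    simp [Linear.smul_comp]
    exact ((Linear.comp_smul (R := R) _ X X (P.π.f 0) r (𝟙 X)).trans
      (congrArg (r • ·) (Category.comp_id _))).symm)]
  have h := ((F.mapHomologicalComplex (ComplexShape.down ℕ)) ⋙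
    HomologicalComplex.homologyFunctor D _ n).map_smul r (𝟙 P.complex)
  rw [h, CategoryTheory.Functor.map_id, Linear.smul_comp, Linear.comp_smul]
  erw [Category.id_comp]
  rw [Iso.hom_inv_id]

/-- Ext is derived in its first variable, with values in the opposite category, so r acts on it
through its zero action on R/J. -/
theorem smul_ext_eq_zero {R : Type u} [CommRing R] (J : Ideal R) (n : ℕ) (N : ModuleCat.{u} R)
    (r : R) (hr : r ∈ J)
    (y : ((Ext R (ModuleCat.{u} R) n).obj (op (ModuleCat.of R (R ⧸ J)))).obj N) : r • y = 0 := by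
  let := oppositeLinear R (ModuleCat.{u} R)
  let F := ((linearYoneda R (ModuleCat.{u} R)).obj N).rightOp
  have : F.Linear R := ⟨fun f s => Quiver.Hom.unop_inj (by
    ext g
    exact Linear.smul_comp _ _ _ s f g)⟩
  -- The zero map is written as a scalar multiple so that `leftDerived_map_smul_id` evaluates both
  -- sides.
  have h0 : r • 𝟙 (ModuleCat.of R (R ⧸ J)) = (0 : R) • 𝟙 _ := by
    ext
    change r • (Ideal.Quotient.mk J 1) = (0 : R) • (Ideal.Quotient.mk J 1)
    rw [zero_smul]
    exact Ideal.Quotient.eq_zero_iff_mem.2 (by simpa using hr)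
  have h := leftDerived_map_smul_id F n r (ModuleCat.of R (R ⧸ J))
  rw [h0, leftDerived_map_smul_id, zero_smul] at h
  exact (congrArg (fun f => f.unop.hom y) h).symm

/-- An element of the filtered colimit of the Ext^n(R/I^t, N) comes from some stage t, where I^t
acts as zero. -/
theorem exists_pow_smul_localCohomology_eq_zero {R : Type u} [CommRing R] (I : Ideal R) (n : ℕ)
    (N : ModuleCat.{u} R)
    (y : (localCohomology I n).obj N) : ∃ t : ℕ, ∀ r ∈ I ^ t, r • y = 0 := by
  let G := localCohomology.diagram (localCohomology.idealPowersDiagram I) n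
  have hasC : HasColimit G := localCohomology.hasColimitDiagram.{u, 0} _ _
  let hc := isColimitOfPreserves ((evaluation _ _).obj N) (colimit.isColimit G)
  have : PreservesFilteredColimitsOfSize.{0, 0} (forget (ModuleCat.{u} R)) :=
    preservesFilteredColimitsOfSize_shrink.{0, u, 0, u} _
  let hc' := isColimitOfPreserves (forget (ModuleCat.{u} R)) hc
  obtain ⟨j, z, rfl⟩ := Types.jointly_surjective_of_isColimit hc' y
  refine ⟨j.unop.unop, fun r hr => ?_⟩
  have := smul_ext_eq_zero (I ^ j.unop.unop) n N r hr z
  change r • ((((evaluation _ _).obj N).mapCocone (colimit.cocone G)).ι.app j).hom z = 0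
  rw [← map_smul]
  exact (congrArg _ this).trans (map_zero _)

end LocalCohomologyTorsion

theorem mainTheorem4 {R : Type u} [CommRing R] [IsLocalRing R] [IsNoetherianRing R]
    (E : Type u) [AddCommGroup E] [Module R E]
    (ι : IsLocalRing.ResidueField R →ₗ[R] E) (hE : IsInjectiveHull ι)
    (I : Ideal R) (n h : ℕ) (x : Fin h → R) (hx : ∀ i, x i ∈ I)
    (N : Type u) [AddCommGroup N] [Module R N] :
    RingTheory.Sequence.IsWeaklyRegular
        (MatlisDual R E ((localCohomology I n).obj (ModuleCat.of R N))) (List.ofFn x) ↔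
      Function.Injective
        (canonicalMap x (MatlisDual R E ((localCohomology I n).obj (ModuleCat.of R N)))) := by
  have hC := hE.isCogenerator
  rw [isWeaklyRegular_dual_iff_isCoregular hE.injective_module hC,
    canonicalMap_dual_injective_iff hE.injective_module hC]
  refine isCoregular_ofFn_iff_prodPowSurjective fun y => ?_
  obtain ⟨t, ht⟩ := exists_pow_smul_localCohomology_eq_zero I n _ y
  refine ⟨t, fun r hr => ht r (Ideal.pow_right_mono (Ideal.span_le.2 ?_) t hr)⟩
  rintro _ ⟨i, rfl⟩
  exact hx i
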